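/- Let $A$ be a finite set. A set system on $A$ is a pair $(A;R)$ where $R$ is a set of non-empty subsets of $A$ such that the predimension $\delta(X)=|X|-|\{r\in R: r\subseteq X\}|$ is non-negative for every $X\subseteq A$. For $k\in\mathbb{N}\cup\{\infty\}$, let $\mathcal{C}_k$ be the class of (finite) set systems in which every $r\in R$ has size at most $k$ (no bound if $k=\infty$). A subset $C\subseteq A$ is self-sufficient in $(A;R)$, written $C\le (A;R)$, if $\delta(C)\le\delta(Y)$ whenever $C\subseteq Y\subseteq A$. Put $d(X)=\min\{\delta(Y): X\subseteq Y\subseteq A\}$; then $\mathrm{cl}(X)=\{y\in A: d(X\cup\{y\})=d(X)\}$ is the closure operation of a pregeometry $PG(A;R)$ on $A$, where a pregeometry is a set with a finitary closure operation satisfying the exchange property. A presentation of a pregeometry $\mathcal{A}=(A,\mathrm{cl})$ is a set system $(A;R)$ with $PG(A;R)=\mathcal{A}$; let $PG(\mathcal{C}_k)$ be the class of pregeometries that have a presentation in $\mathcal{C}_k$, and for $C\subseteq A$ write $C\unlhd_k\mathcal{A}$ if there is a presentation $(A;R)\in\mathcal{C}_k$ of $\mathcal{A}$ with $C\le(A;R)$.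 Let $k\in\mathbb{N}\cup\{\infty\}$, let $\mathcal{A}=(A,\mathrm{cl})\in PG(\mathcal{C}_k)$ and let $C\subseteq A$. If $C\unlhd_\infty\mathcal{A}$, then $C\unlhd_k\mathcal{A}$. Hence, on $PG(\mathcal{C}_k)$, the relations $\unlhd_k$ and $\unlhd_\infty$ coincide: $C\unlhd_\infty\mathcal{A}$ if and only if $C\unlhd_k\mathcal{A}$. -/

import Mathlib

open scoped Classical in
/-- The finite set `R[X]` of the members of `R` that are contained in the finite set `X`. -/
noncomputable def relationsIn {A : Type*} (R : Set (Finset A)) (X : Finset A) :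
    Finset (Finset A) :=
  X.powerset.filter (fun r => r ∈ R)

/-- The predimension `δ(X) = |X| - |R[X]|` of a finite set `X` (an integer). -/
noncomputable def predimension {A : Type*} (R : Set (Finset A)) (X : Finset A) : ℤ :=
  (X.card : ℤ) - ((relationsIn R X).card : ℤ)

/-- A set system `(A; R)`: a set `R` of finite, non-empty subsets of `A` such that every finite
subset of `A` has non-negative predimension. -/
structure SetSystem (A : Type*) where
  rel : Set (Finset A)
  nonempty_of_mem : ∀ r ∈ rel, r.Nonempty
  predimension_nonneg : ∀ X : Finset A, 0 ≤ predimension rel X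

/-- A pregeometry on `A`: a closure operator on the subsets of `A` that is finitary and has the
exchange property. -/
structure Pregeometry (A : Type*) extends ClosureOperator (Set A) where
  finitary : ∀ (X : Set A) (y : A), y ∈ toFun X → ∃ Y : Finset A, (Y : Set A) ⊆ X ∧ y ∈ toFun Y
  exchange : ∀ (X : Set A) (x y : A), y ∈ toFun (insert x X) → y ∉ toFun X →
    x ∈ toFun (insert y X)

namespace Pregeometry

/-- The closure operation of a pregeometry. -/
def cl {A : Type*} (P : Pregeometry A) (X : Set A) : Set A := P.toClosureOperator X

/-- A pregeometry is determined by its closure operation. -/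
theorem ext_cl {A : Type*} {P Q : Pregeometry A} (h : ∀ X, P.cl X = Q.cl X) : P = Q := by
  obtain ⟨p, _, _⟩ := P
  obtain ⟨q, _, _⟩ := Q
  have : p = q := ClosureOperator.ext _ _ h
  subst this
  rfl

end Pregeometry

namespace SetSystem

variable {A : Type*} (S : SetSystem A)

/-- The predimension function of a set system. -/
noncomputable def delta (X : Finset A) : ℤ := predimension S.rel X

/-- `X ≤ (A; R)`: the finite set `X` is self-sufficient in the set system. -/
def SelfSufficient (X : Finset A) : Prop := ∀ Y : Finset A, X ⊆ Y → S.delta X ≤ S.delta Y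

/-- The dimension `d(X)`: the minimum of `δ(Y)` over the finite sets `Y` containing `X`. -/
noncomputable def dim (X : Finset A) : ℤ := sInf {n : ℤ | ∃ Y : Finset A, X ⊆ Y ∧ S.delta Y = n}

open scoped Classical in
/-- The closure of a finite set `X` is `{y | d(X ∪ {y}) = d(X)}`; the closure of an arbitrary set
is the union of the closures of its finite subsets. -/
noncomputable def cl (X : Set A) : Set A :=
  {y | ∃ Y : Finset A, (Y : Set A) ⊆ X ∧ S.dim (insert y Y) = S.dim Y}

/-- All the sets in `R` have size at most `k`, where `k = ⊤` imposes no bound. For finite `A` this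
says that `(A; R)` belongs to the class `𝒞_k`. -/
def SizeLE (k : ℕ∞) : Prop := ∀ r ∈ S.rel, (r.card : ℕ∞) ≤ k

theorem dim_le {X Y : Finset A} (h : X ⊆ Y) : S.dim X ≤ S.delta Y :=
  csInf_le ⟨0, by rintro n ⟨Y, _, rfl⟩; exact S.predimension_nonneg Y⟩ ⟨Y, h, rfl⟩

/-- The minimum that defines `d(X)` is attained. -/
theorem exists_dim_eq (X : Finset A) : ∃ Y : Finset A, X ⊆ Y ∧ S.delta Y = S.dim X :=
  Int.csInf_mem (s := {n : ℤ | ∃ Y : Finset A, X ⊆ Y ∧ S.delta Y = n})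
    ⟨_, X, Finset.Subset.refl X, rfl⟩
    ⟨0, by rintro n ⟨Y, _, rfl⟩; exact S.predimension_nonneg Y⟩

theorem dim_mono {X Y : Finset A} (h : X ⊆ Y) : S.dim X ≤ S.dim Y := by
  obtain ⟨Z, hZ, e⟩ := S.exists_dim_eq Y
  exact e ▸ S.dim_le (h.trans hZ)

open scoped Classical in
theorem delta_submodular (X Y : Finset A) :
    S.delta (X ∪ Y) + S.delta (X ∩ Y) ≤ S.delta X + S.delta Y := by
  have h1 := Finset.card_union_add_card_inter X Y
  have h2 := Finset.card_union_add_card_inter (relationsIn S.rel X) (relationsIn S.rel Y)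
  have h3 : relationsIn S.rel X ∩ relationsIn S.rel Y = relationsIn S.rel (X ∩ Y) := by
    ext r
    simp only [relationsIn, Finset.mem_inter, Finset.mem_filter, Finset.mem_powerset,
      Finset.subset_inter_iff]
    tauto
  have h4 : (relationsIn S.rel X ∪ relationsIn S.rel Y).card
      ≤ (relationsIn S.rel (X ∪ Y)).card := by
    apply Finset.card_le_card
    intro r
    simp only [relationsIn, Finset.mem_union, Finset.mem_filter, Finset.mem_powerset]
    rintro (⟨h, h'⟩ | ⟨h, h'⟩)
    · exact ⟨h.trans Finset.subset_union_left, h'⟩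
    · exact ⟨h.trans Finset.subset_union_right, h'⟩
  rw [h3] at h2
  simp only [delta, predimension]
  omega

open scoped Classical in
theorem dim_submodular (X Y : Finset A) :
    S.dim (X ∪ Y) + S.dim (X ∩ Y) ≤ S.dim X + S.dim Y := by
  obtain ⟨X', hX, eX⟩ := S.exists_dim_eq X
  obtain ⟨Y', hY, eY⟩ := S.exists_dim_eq Y
  have h1 := S.delta_submodular X' Y'
  have h2 := S.dim_le (Finset.union_subset_union hX hY)
  have h3 := S.dim_le (Finset.inter_subset_inter hX hY)
  omega

open scoped Classical in
theorem dim_insert_le (x : A) (X : Finset A) : S.dim (insert x X) ≤ S.dim X + 1 := by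
  obtain ⟨Y, hY, e⟩ := S.exists_dim_eq X
  have h1 := S.dim_le (Finset.insert_subset_insert x hY)
  have h2 := Finset.card_insert_le x Y
  have h3 : (relationsIn S.rel Y).card ≤ (relationsIn S.rel (insert x Y)).card := by
    apply Finset.card_le_card
    intro r
    simp only [relationsIn, Finset.mem_filter, Finset.mem_powerset]
    exact fun h => ⟨h.1.trans (Finset.subset_insert x Y), h.2⟩
  simp only [delta, predimension] at *
  omega

open scoped Classical in
theorem dim_insert_eq_of_subset {X Y : Finset A} (h : X ⊆ Y) {y : A}
    (hy : S.dim (insert y X) = S.dim X) : S.dim (insert y Y) = S.dim Y := by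
  have h1 := S.dim_submodular Y (insert y X)
  have h2 : Y ∪ insert y X = insert y Y := by
    rw [Finset.union_insert, Finset.union_eq_left.2 h]
  have h3 : X ⊆ Y ∩ insert y X := Finset.subset_inter h (Finset.subset_insert y X)
  have h4 := S.dim_mono h3
  have h5 := S.dim_mono (Finset.subset_insert y Y)
  rw [h2] at h1
  omega

open scoped Classical in
/-- On finite sets the closure is given by the defining formula. -/
theorem mem_cl_coe {X : Finset A} {y : A} :
    y ∈ S.cl (X : Set A) ↔ S.dim (insert y X) = S.dim X := by
  constructor
  · rintro ⟨Y, hY, h⟩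
    exact S.dim_insert_eq_of_subset (Finset.coe_subset.1 hY) h
  · exact fun h => ⟨X, subset_rfl, h⟩

theorem subset_cl (X : Set A) : X ⊆ S.cl X := by
  intro x hx
  exact ⟨{x}, by simpa using hx, by simp⟩

theorem cl_mono {X Y : Set A} (h : X ⊆ Y) : S.cl X ⊆ S.cl Y := by
  rintro y ⟨Z, hZ, e⟩
  exact ⟨Z, hZ.trans h, e⟩

open scoped Classical in
theorem exists_dim_union_eq (X : Set A) (Z : Finset A) (hZ : (Z : Set A) ⊆ S.cl X) :
    ∃ Y : Finset A, (Y : Set A) ⊆ X ∧ S.dim (Y ∪ Z) = S.dim Y := by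
  induction Z using Finset.induction_on with
  | empty => exact ⟨∅, by simp, by simp⟩
  | insert z Z _ ih =>
    obtain ⟨Y, hY, e⟩ := ih (fun a ha => hZ (by simp at ha ⊢; exact Or.inr ha))
    obtain ⟨W, hW, f⟩ := hZ (show z ∈ ((insert z Z : Finset A) : Set A) by simp)
    refine ⟨Y ∪ W, by simpa using ⟨hY, hW⟩, ?_⟩
    have h1 := S.dim_insert_eq_of_subset
      (show W ⊆ Y ∪ W ∪ Z from Finset.subset_union_right.trans Finset.subset_union_left) f
    have h2 := S.dim_submodular (Y ∪ W) (Y ∪ Z)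
    have h3 : Y ∪ W ∪ (Y ∪ Z) = Y ∪ W ∪ Z := by ext; simp; tauto
    have h4 : S.dim Y ≤ S.dim ((Y ∪ W) ∩ (Y ∪ Z)) :=
      S.dim_mono (Finset.subset_inter Finset.subset_union_left Finset.subset_union_left)
    have h5 : S.dim (Y ∪ W) ≤ S.dim (Y ∪ W ∪ Z) := S.dim_mono Finset.subset_union_left
    rw [h3] at h2
    rw [Finset.union_insert]
    omega

theorem cl_cl (X : Set A) : S.cl (S.cl X) = S.cl X := by
  classical
  apply subset_antisymm _ (S.subset_cl _)
  rintro y ⟨Z, hZ, e⟩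
  obtain ⟨Y, hY, f⟩ := S.exists_dim_union_eq X Z hZ
  refine ⟨Y, hY, ?_⟩
  have h1 := S.dim_insert_eq_of_subset (Finset.subset_union_right : Z ⊆ Y ∪ Z) e
  have h2 := S.dim_mono (Finset.insert_subset_insert y (Finset.subset_union_left : Y ⊆ Y ∪ Z))
  have h3 := S.dim_mono (Finset.subset_insert y Y)
  omega

theorem cl_exchange (X : Set A) (x y : A) (h : y ∈ S.cl (insert x X)) (h' : y ∉ S.cl X) :
    x ∈ S.cl (insert y X) := by
  classical
  obtain ⟨Z, hZ, e⟩ := h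
  have hY : ((Z.erase x : Finset A) : Set A) ⊆ X := by
    intro a ha
    simp only [Finset.coe_erase, Set.mem_sdiff, Set.mem_singleton_iff] at ha
    exact (hZ ha.1).resolve_left ha.2
  have hZY : Z ⊆ insert x (Z.erase x) := Finset.insert_erase_subset x Z
  generalize Z.erase x = Y at hY hZY
  have h1 := S.dim_insert_eq_of_subset hZY e
  have h2 : S.dim (insert y Y) ≠ S.dim Y := fun h => h' ⟨Y, hY, h⟩
  have h3 := S.dim_mono (Finset.subset_insert y Y)
  have h4 := S.dim_insert_le x Y
  have h5 := S.dim_mono (Finset.subset_insert x (insert y Y))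
  refine ⟨insert y Y, by simpa using Set.insert_subset_insert hY, ?_⟩
  rw [Finset.insert_comm] at h1
  omega

/-- The pregeometry `PG(A; R)` of a set system. -/
noncomputable def PG : Pregeometry A where
  toClosureOperator :=
    ClosureOperator.mk' S.cl (fun _ _ h => S.cl_mono h) S.subset_cl (fun X => (S.cl_cl X).le)
  finitary := by
    rintro X y ⟨Y, hY, e⟩
    exact ⟨Y, hY, Y, subset_rfl, e⟩
  exchange := S.cl_exchange

theorem cl_PG (X : Set A) : S.PG.cl X = S.cl X := rfl

end SetSystem

/-- `(A; R)` is a presentation of the pregeometry `P` if `PG(A; R) = P`. -/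
def SetSystem.Presents {A : Type*} (S : SetSystem A) (P : Pregeometry A) : Prop := S.PG = P

/-- For finite `A`: the pregeometry `P` on `A` belongs to the class `PG(𝒞_k)`. -/
def Pregeometry.InPG {A : Type*} (k : ℕ∞) (P : Pregeometry A) : Prop :=
  ∃ S : SetSystem A, S.SizeLE k ∧ S.Presents P

/-- For finite `A`: the relation `C ⊴_k P`, that is, `C` is self-sufficient in some presentation
of `P` in `𝒞_k`. -/
def Pregeometry.SelfSufficientIn {A : Type*} (k : ℕ∞) (C : Finset A) (P : Pregeometry A) : Prop :=
  ∃ S : SetSystem A, S.SizeLE k ∧ S.Presents P ∧ S.SelfSufficient C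

/-! In any presentation a relation `r` satisfies `|r| ≥ d(r) + 1`, since `r` itself is counted in
`δ(r)`. A presentation in which equality always holds uses the smallest possible relations. For each
closed set, the number of relations with that closure depends only on the pregeometry, so every
relation of such a presentation is matched, in a presentation from `𝒞_k`, by one of equal dimension
and at least equal size. It thus remains to reach equality while keeping `C` self-sufficient.

If `|r| > d(r) + 1`, then some `x ∈ r` lies in every self-sufficient set containing `r \ {x}`
(`card_le_dim_add_one`). For `r` of least size, replacing it by `r \ {x}` lowers `δ` only on sets
that are not self-sufficient, hence preserves `d` (`exists_erase_presents`). This can be iterated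
until equality holds. -/

/-! ### Counting relations by closure -/

open scoped Classical in
/-- A family indexed by a finite set has, over each point, as many members whose closure is that
point as any other family with the same number of members below each closed point. -/
theorem card_closure_fiber_eq {ι α : Type*} [PartialOrder α] [Finite α] (c : ClosureOperator α)
    (f : ι → α) (R S : Finset ι)
    (h : ∀ F, c.IsClosed F → (R.filter fun r => f r ≤ F).card = (S.filter fun r => f r ≤ F).card)
    (F : α) :
    (R.filter fun r => c (f r) = F).card = (S.filter fun r => c (f r) = F).card := by
  have := Fintype.ofFinite α
  -- For closed `F`, the members below `F` are those with closure at most `F`; subtracting the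
  -- fibres strictly below leaves the fibre over `F`. Over a non-closed `F` the fibre is empty.
  induction F using WellFoundedLT.induction with
  | ind F ih =>
    by_cases hF : c.IsClosed F
    · have key : ∀ T : Finset ι, (T.filter fun r => f r ≤ F).card =
          (T.filter fun r => c (f r) = F).card +
            ∑ G ∈ Finset.univ.filter (· < F), (T.filter fun r => c (f r) = G).card := by
        intro T
        have h1 := Finset.card_eq_sum_card_fiberwise (s := T.filter fun r => f r ≤ F)
          (t := Finset.univ.filter (· ≤ F)) (f := fun r => c (f r)) (by
            intro r hr
            simp only [Finset.coe_filter, Set.mem_ofPred_eq, Finset.mem_univ, true_and] at hr ⊢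
            exact hF.closure_le_iff.2 hr.2)
        have h2 : Finset.univ.filter (· ≤ F) = insert F (Finset.univ.filter (· < F)) := by
          ext G
          simp [le_iff_eq_or_lt]
        rw [h1, h2, Finset.sum_insert (by simp)]
        have h3 : ∀ G ≤ F, (T.filter fun r => f r ≤ F).filter (fun r => c (f r) = G) =
            T.filter fun r => c (f r) = G := by
          intro G hG
          ext r
          simp only [Finset.mem_filter]
          constructor
          · exact fun h => ⟨h.1.1, h.2⟩
          · exact fun h => ⟨⟨h.1, (c.le_closure (f r)).trans (h.2.le.trans hG)⟩, h.2⟩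
        rw [h3 F le_rfl]
        congr 1
        exact Finset.sum_congr rfl fun G hG => by
          rw [h3 G (Finset.mem_filter.1 hG).2.le]
      have h1 := key R
      have h2 := key S
      have h3 : ∑ G ∈ Finset.univ.filter (· < F), (R.filter fun r => c (f r) = G).card =
          ∑ G ∈ Finset.univ.filter (· < F), (S.filter fun r => c (f r) = G).card :=
        Finset.sum_congr rfl fun G hG => ih G (by simpa using hG)
      have h4 := h F hF
      omega
    · have key : ∀ T : Finset ι, (T.filter fun r => c (f r) = F) = ∅ := by
        intro T
        refine Finset.filter_eq_empty_iff.2 fun r _ e => hF ?_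
        rw [← e]
        exact c.isClosed_closure _
      rw [key R, key S]

/-! ### Data determined by the pregeometry -/

namespace SetSystem

variable {A : Type*} (S : SetSystem A)

theorem mem_relationsIn {R : Set (Finset A)} {X r : Finset A} :
    r ∈ relationsIn R X ↔ r ⊆ X ∧ r ∈ R := by
  simp [relationsIn]

theorem dim_nonneg (X : Finset A) : 0 ≤ S.dim X := by
  obtain ⟨Y, _, e⟩ := S.exists_dim_eq X
  exact e ▸ S.predimension_nonneg Y

theorem dim_empty : S.dim ∅ = 0 := by
  refine le_antisymm ((S.dim_le subset_rfl).trans ?_) (S.dim_nonneg ∅)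
  simp [delta, predimension]

theorem selfSufficient_iff_delta_le_dim {X : Finset A} :
    S.SelfSufficient X ↔ S.delta X ≤ S.dim X := by
  constructor
  · intro h
    obtain ⟨Y, hY, e⟩ := S.exists_dim_eq X
    exact e ▸ h Y hY
  · exact fun h Y hY => h.trans (S.dim_le hY)

theorem dim_lt_card {r : Finset A} (hr : r ∈ S.rel) : S.dim r + 1 ≤ r.card := by
  have h := S.dim_le (subset_refl r)
  have h' : 0 < (relationsIn S.rel r).card :=
    Finset.card_pos.2 ⟨r, mem_relationsIn.2 ⟨subset_rfl, hr⟩⟩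
  simp only [delta, predimension] at h
  omega

/-- Set systems with the same closure operation have the same dimension function. -/
theorem dim_eq_of_cl_eq {S T : SetSystem A} (h : ∀ X, S.cl X = T.cl X) (X : Finset A) :
    S.dim X = T.dim X := by
  classical
  induction X using Finset.induction_on with
  | empty => rw [dim_empty, dim_empty]
  | insert y X _ ih =>
    have h1 := S.dim_insert_le y X
    have h2 := T.dim_insert_le y X
    have h3 := S.dim_mono (Finset.subset_insert y X)
    have h4 := T.dim_mono (Finset.subset_insert y X)
    -- Each increment of `d` is 0 or 1, and the closure decides which.
    have h5 : S.dim (insert y X) = S.dim X ↔ T.dim (insert y X) = T.dim X := by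
      rw [← S.mem_cl_coe, ← T.mem_cl_coe, h]
    by_cases h6 : S.dim (insert y X) = S.dim X
    · rw [h6, h5.1 h6, ih]
    · have h7 := mt h5.2 h6
      omega

theorem cl_eq_of_dim_eq {S T : SetSystem A} (h : ∀ X, S.dim X = T.dim X) (X : Set A) :
    S.cl X = T.cl X := by
  simp only [cl, h]

theorem dim_eq_of_presents {S T : SetSystem A} {P : Pregeometry A} (hS : S.Presents P)
    (hT : T.Presents P) (X : Finset A) : S.dim X = T.dim X :=
  dim_eq_of_cl_eq (fun Y => by rw [← cl_PG, ← cl_PG, hS, hT]) X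

/-- A set attaining the minimum in `d(X)` lies in the closure of `X`. -/
theorem delta_eq_dim_of_cl_eq {X : Finset A} (h : S.cl (X : Set A) = X) :
    S.delta X = S.dim X := by
  classical
  obtain ⟨Y, hY, e⟩ := S.exists_dim_eq X
  suffices hYX : Y ⊆ X by rwa [hYX.antisymm hY] at e
  intro y hy
  have h1 : y ∈ S.cl (X : Set A) :=
    S.mem_cl_coe.2 (le_antisymm (e ▸ S.dim_le (Finset.insert_subset hy hY))
      (S.dim_mono (Finset.subset_insert y X)))
  rw [h] at h1
  exact Finset.mem_coe.1 h1

theorem dim_eq_of_coe_eq_cl {X Y : Finset A} (h : (Y : Set A) = S.cl X) :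
    S.dim Y = S.dim X := by
  classical
  have hXY : X ⊆ Y := by
    rw [← Finset.coe_subset, h]
    exact S.subset_cl _
  obtain ⟨Z, hZ, e⟩ := S.exists_dim_union_eq X Y h.le
  have h1 := S.dim_mono (Finset.subset_union_right : Y ⊆ Z ∪ Y)
  have h2 := S.dim_mono (Finset.coe_subset.1 hZ)
  exact le_antisymm (by omega) (S.dim_mono hXY)

/-- Two presentations of a pregeometry have the same closures of relations. -/
theorem exists_mem_rel_cl_eq [Finite A] {S T : SetSystem A} {P : Pregeometry A}
    (hS : S.Presents P) (hT : T.Presents P) {s : Finset A} (hs : s ∈ S.rel) :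
    ∃ r ∈ T.rel, P.cl (r : Set A) = P.cl (s : Set A) := by
  classical
  have := Fintype.ofFinite A
  -- On closed sets `δ = d`, so this count is the same for all presentations of `P`.
  have key : ∀ U : SetSystem A, U.Presents P → ∀ X : Finset A, P.cl (X : Set A) = X →
      (((relationsIn U.rel Finset.univ).filter fun r : Finset A => (r : Set A) ≤ X).card : ℤ) =
        X.card - U.dim X := by
    intro U hU X hX
    rw [← hU, cl_PG] at hX
    rw [← U.delta_eq_dim_of_cl_eq hX, delta, predimension, sub_sub_cancel]
    congr 2
    ext r
    simp only [Finset.mem_filter, mem_relationsIn, Finset.subset_univ, true_and, Finset.coe_subset]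
    tauto
  have h := card_closure_fiber_eq P.toClosureOperator (fun r : Finset A => (r : Set A))
    (relationsIn S.rel Finset.univ) (relationsIn T.rel Finset.univ) (fun F hF => by
      obtain ⟨X, rfl⟩ : ∃ X : Finset A, (X : Set A) = F := ⟨F.toFinset, by simp⟩
      have hX : P.cl (X : Set A) = X := hF.closure_eq
      have h1 := key S hS X hX
      have h2 := key T hT X hX
      rw [dim_eq_of_presents hS hT] at h1
      exact_mod_cast h1.trans h2.symm) (P.cl (s : Set A))
  have hpos := h.symm.trans_ne (Finset.card_ne_zero_of_mem (Finset.mem_filter.2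
    ⟨mem_relationsIn.2 ⟨Finset.subset_univ s, hs⟩, (rfl : P.toClosureOperator (s : Set A) = _)⟩))
  obtain ⟨r, hr⟩ := Finset.card_ne_zero.1 hpos
  rw [Finset.mem_filter, mem_relationsIn] at hr
  exact ⟨r, hr.1.2, hr.2⟩

/-! ### Shrinking relations -/

open scoped Classical in
/-- If each element `x` of a relation `r` can be separated from the rest of `r` by a
self-sufficient set, then `|r| ≤ d(r) + 1`. -/
theorem card_le_dim_add_one {r : Finset A} (hr : r ∈ S.rel)
    (h : ∀ x ∈ r, ∃ Y, r.erase x ⊆ Y ∧ x ∉ Y ∧ S.SelfSufficient Y) :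
    (r.card : ℤ) ≤ S.dim r + 1 := by
  obtain ⟨x₁, hx₁⟩ := S.nonempty_of_mem r hr
  -- Intersecting with the separating sets removes the points of `T` from `Y` one at a time, and
  -- each intersection costs at least 1 in `δ`.
  have key : ∀ T ⊆ r.erase x₁, ∃ Y, S.SelfSufficient Y ∧ Y ∩ r = r.erase x₁ \ T ∧
      S.delta Y ≤ S.dim (r.erase x₁) - T.card := by
    intro T
    induction T using Finset.induction_on with
    | empty =>
      intro _
      obtain ⟨Z, hZ, hxZ, hZs⟩ := h x₁ hx₁
      obtain ⟨W, hW, eW⟩ := S.exists_dim_eq (r.erase x₁)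
      have h1 := S.delta_submodular W Z
      have h2 := hZs (W ∪ Z) Finset.subset_union_right
      refine ⟨W ∩ Z, ?_, ?_, ?_⟩
      · rw [selfSufficient_iff_delta_le_dim]
        have := S.dim_mono (Finset.subset_inter hW hZ)
        omega
      · ext a
        have := @hW a
        have := @hZ a
        simp only [Finset.mem_inter, Finset.mem_erase, Finset.sdiff_empty] at *
        constructor
        · rintro ⟨⟨_, ha⟩, har⟩
          exact ⟨fun e => hxZ (e ▸ ha), har⟩
        · tauto
      · simp
        omega
    | insert x T hxT ih =>
      intro hT
      obtain ⟨hx, hT⟩ := Finset.insert_subset_iff.1 hT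
      obtain ⟨Y, hY, hYr, hYd⟩ := ih hT
      have hxr := Finset.mem_of_mem_erase hx
      obtain ⟨Z, hZ, hxZ, hZs⟩ := h x hxr
      have hx₁Y : x₁ ∉ Y := fun hh => by
        have : x₁ ∈ Y ∩ r := Finset.mem_inter.2 ⟨hh, hx₁⟩
        rw [hYr] at this
        simp at this
      have hxY : x ∈ Y := by
        have : x ∈ Y ∩ r := by
          rw [hYr]
          exact Finset.mem_sdiff.2 ⟨hx, hxT⟩
        exact (Finset.mem_inter.1 this).1
      have hrU : r ⊆ Y ∪ Z := by
        intro a ha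
        by_cases e : a = x
        · exact Finset.mem_union_left _ (e ▸ hxY)
        · exact Finset.mem_union_right _ (hZ (Finset.mem_erase.2 ⟨e, ha⟩))
      -- Submodularity is strict here: `r` lies in `Y ∪ Z` but in neither `Y` nor `Z`.
      have hsub : S.delta (Y ∪ Z) + S.delta (Y ∩ Z) + 1 ≤ S.delta Y + S.delta Z := by
        have h1 := Finset.card_union_add_card_inter Y Z
        have h2 := Finset.card_union_add_card_inter (relationsIn S.rel Y) (relationsIn S.rel Z)
        have h3 : relationsIn S.rel Y ∩ relationsIn S.rel Z = relationsIn S.rel (Y ∩ Z) := by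
          ext a
          simp only [mem_relationsIn, Finset.mem_inter, Finset.subset_inter_iff]
          tauto
        have hr' : r ∉ relationsIn S.rel Y ∪ relationsIn S.rel Z := by
          simp only [Finset.mem_union, mem_relationsIn]
          rintro (⟨h, _⟩ | ⟨h, _⟩)
          · exact hx₁Y (h hx₁)
          · exact hxZ (h hxr)
        have h4 : (insert r (relationsIn S.rel Y ∪ relationsIn S.rel Z)).card ≤
            (relationsIn S.rel (Y ∪ Z)).card := by
          apply Finset.card_le_card
          intro a
          simp only [Finset.mem_insert, Finset.mem_union, mem_relationsIn]
          rintro (rfl | ⟨h, h'⟩ | ⟨h, h'⟩)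
          · exact ⟨hrU, hr⟩
          · exact ⟨h.trans Finset.subset_union_left, h'⟩
          · exact ⟨h.trans Finset.subset_union_right, h'⟩
        rw [Finset.card_insert_of_notMem hr'] at h4
        rw [h3] at h2
        simp only [delta, predimension]
        omega
      refine ⟨Y ∩ Z, ?_, ?_, ?_⟩
      · intro V hV
        have h1 := S.delta_submodular V Y
        have h2 := hY (V ∪ Y) Finset.subset_union_right
        have h3 := S.delta_submodular (V ∩ Y) Z
        have h4 := hZs (V ∩ Y ∪ Z) Finset.subset_union_right
        have h5 : V ∩ Y ∩ Z = Y ∩ Z := by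
          ext a
          have := @hV a
          simp only [Finset.mem_inter] at *
          tauto
        rw [h5] at h3
        omega
      · ext a
        have h1 := Finset.ext_iff.1 hYr a
        have h2 := @hZ a
        have h3 : a = x → a ∉ Z := fun e => e ▸ hxZ
        simp only [Finset.mem_inter, Finset.mem_sdiff, Finset.mem_erase, Finset.mem_insert] at *
        tauto
      · have := hZs (Y ∪ Z) Finset.subset_union_right
        rw [Finset.card_insert_of_notMem hxT]
        push_cast
        omega
  -- Removing all of `r \ {x₁}` gives `0 ≤ d(r \ {x₁}) - (|r| - 1)`.
  obtain ⟨Y, _, _, hY⟩ := key _ subset_rfl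
  have h1 : 0 ≤ S.delta Y := S.predimension_nonneg Y
  have h2 := S.dim_mono (Finset.erase_subset x₁ r)
  have h3 := Finset.card_erase_add_one hx₁
  omega

open scoped Classical in
/-- Removing an element from a relation that is not a circuit: for a relation `r` of least size
with `|r| > d(r) + 1`, some `x ∈ r` can be removed without changing the dimension function. -/
theorem exists_erase_presents [Finite A] {S : SetSystem A} {P : Pregeometry A} {C : Finset A}
    (hS : S.Presents P) (hC : S.SelfSufficient C)
    (h : ¬ ∀ r ∈ S.rel, (r.card : ℤ) ≤ S.dim r + 1) :
    ∃ T : SetSystem A, T.Presents P ∧ T.SelfSufficient C ∧ ∃ r ∈ S.rel, ∃ x ∈ r,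
      r.erase x ∉ S.rel ∧ T.rel = insert (r.erase x) (S.rel \ {r}) := by
  have hne : {r | r ∈ S.rel ∧ ¬ (r.card : ℤ) ≤ S.dim r + 1}.Nonempty := by
    push Not at h
    obtain ⟨r, hr, h⟩ := h
    exact ⟨r, hr, not_le.2 h⟩
  obtain ⟨r, ⟨hr, hrd⟩, hmin⟩ := exists_minimalFor_of_wellFoundedLT
    (fun r => r ∈ S.rel ∧ ¬ (r.card : ℤ) ≤ S.dim r + 1) Finset.card hne
  obtain ⟨x, hx, hsep⟩ : ∃ x ∈ r, ∀ Y, r.erase x ⊆ Y → S.SelfSufficient Y → x ∈ Y := by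
    by_contra! hcon
    exact hrd (S.card_le_dim_add_one hr fun x hx => by
      obtain ⟨Y, h1, h2, h3⟩ := hcon x hx
      exact ⟨Y, h1, h3, h2⟩)
  -- Otherwise minimality of `r` gives `|r \ {x}| ≤ d(r \ {x}) + 1`, which makes the relation `r \
  -- {x}` self-sufficient although it omits `x`.
  have hnot : r.erase x ∉ S.rel := by
    intro hmem
    have h1 : ((r.erase x).card : ℤ) ≤ S.dim (r.erase x) + 1 := by
      by_contra hbad
      exact absurd (hmin ⟨hmem, hbad⟩ (Finset.card_erase_lt_of_mem hx).le)
        (not_le.2 (Finset.card_erase_lt_of_mem hx))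
    refine Finset.notMem_erase x r (hsep (r.erase x) subset_rfl ?_)
    rw [selfSufficient_iff_delta_le_dim]
    have h' : 0 < (relationsIn S.rel (r.erase x)).card :=
      Finset.card_pos.2 ⟨_, mem_relationsIn.2 ⟨subset_rfl, hmem⟩⟩
    simp only [delta, predimension]
    omega
  set R : Set (Finset A) := insert (r.erase x) (S.rel \ {r}) with hR
  have hle : ∀ Y, predimension R Y ≤ S.delta Y := by
    intro Y
    have : (relationsIn S.rel Y).card ≤ (relationsIn R Y).card := by
      apply Finset.card_le_card_of_injOn (fun a => if a = r then r.erase x else a)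
      · intro a ha
        rw [Finset.mem_coe, mem_relationsIn] at ha
        rw [Finset.mem_coe, mem_relationsIn]
        dsimp only
        split_ifs with e
        · exact ⟨(Finset.erase_subset x r).trans (e ▸ ha.1), Or.inl rfl⟩
        · exact ⟨ha.1, Or.inr ⟨ha.2, e⟩⟩
      · intro a ha b hb e
        rw [Finset.mem_coe, mem_relationsIn] at ha hb
        dsimp only at e
        split_ifs at e with h1 h2 h2
        · rw [h1, h2]
        · exact absurd (e ▸ hb.2) hnot
        · exact absurd (e ▸ ha.2) hnot
        · exact e
    simp only [delta, predimension]
    omega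
  have hge : ∀ Y, S.dim Y ≤ predimension R Y := by
    intro Y
    have h0 := S.dim_le (subset_refl Y)
    have hins : relationsIn R Y ⊆ insert (r.erase x) (relationsIn S.rel Y) := by
      intro a
      simp only [Finset.mem_insert, mem_relationsIn]
      rintro ⟨ha, rfl | ha'⟩
      · exact Or.inl rfl
      · exact Or.inr ⟨ha, ha'.1⟩
    by_cases h1 : r.erase x ⊆ Y
    · by_cases h2 : x ∈ Y
      · have hrY : r ∈ relationsIn S.rel Y := by
          refine mem_relationsIn.2 ⟨fun a ha => ?_, hr⟩
          by_cases e : a = x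
          · exact e ▸ h2
          · exact h1 (Finset.mem_erase.2 ⟨e, ha⟩)
        have h3 : relationsIn R Y ⊆ insert (r.erase x) ((relationsIn S.rel Y).erase r) := by
          intro a
          simp only [Finset.mem_insert, Finset.mem_erase, mem_relationsIn]
          rintro ⟨ha, rfl | ha'⟩
          · exact Or.inl rfl
          · exact Or.inr ⟨ha'.2, ha, ha'.1⟩
        have h4 := (Finset.card_le_card h3).trans (Finset.card_insert_le _ _)
        rw [Finset.card_erase_add_one hrY] at h4
        simp only [delta, predimension] at *
        omega
      -- Only such `Y` gain a relation; as `δ(Y) > d(Y)`, the loss of 1 is harmless.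
      · have h3 : ¬ S.SelfSufficient Y := fun h => h2 (hsep Y h1 h)
        rw [selfSufficient_iff_delta_le_dim] at h3
        have h4 := (Finset.card_le_card hins).trans (Finset.card_insert_le _ _)
        simp only [delta, predimension] at *
        omega
    · have h3 : relationsIn R Y ⊆ relationsIn S.rel Y := by
        intro a ha
        refine (Finset.mem_insert.1 (hins ha)).resolve_left ?_
        rintro rfl
        exact h1 (mem_relationsIn.1 ha).1
      have h4 := Finset.card_le_card h3
      simp only [delta, predimension] at *
      omega
  have hnonneg : ∀ Y, 0 ≤ predimension R Y := fun Y => (S.dim_nonneg Y).trans (hge Y)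
  let T : SetSystem A :=
    { rel := R
      nonempty_of_mem := by
        intro a ha
        rw [Finset.nonempty_iff_ne_empty]
        rintro rfl
        -- An empty relation would make the predimension of `∅` negative.
        have h1 := hnonneg ∅
        have h2 : 0 < (relationsIn R ∅).card :=
          Finset.card_pos.2 ⟨∅, mem_relationsIn.2 ⟨subset_rfl, ha⟩⟩
        simp only [predimension, Finset.card_empty] at h1
        omega
      predimension_nonneg := hnonneg }
  have hdim : ∀ X, T.dim X = S.dim X := by
    intro X
    apply le_antisymm
    · obtain ⟨Y, hY, e⟩ := S.exists_dim_eq X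
      exact (T.dim_le hY).trans ((hle Y).trans e.le)
    · obtain ⟨Y, hY, e⟩ := T.exists_dim_eq X
      exact (S.dim_mono hY).trans ((hge Y).trans e.le)
  refine ⟨T, ?_, ?_, r, hr, x, hx, hnot, rfl⟩
  · rw [Presents, ← hS]
    exact Pregeometry.ext_cl fun X => by rw [cl_PG, cl_PG, cl_eq_of_dim_eq hdim]
  · rw [selfSufficient_iff_delta_le_dim] at hC ⊢
    rw [hdim]
    exact (hle C).trans hC

/-- A presentation in which `C` is self-sufficient can be shrunk to one in which moreover
`|r| ≤ d(r) + 1` for every relation `r`. -/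
theorem exists_presents_card_le [Finite A] {S : SetSystem A} {P : Pregeometry A} {C : Finset A}
    (hS : S.Presents P) (hC : S.SelfSufficient C) :
    ∃ T : SetSystem A, T.Presents P ∧ T.SelfSufficient C ∧
      ∀ r ∈ T.rel, (r.card : ℤ) ≤ T.dim r + 1 := by
  classical
  have := Fintype.ofFinite A
  -- The total size of the relations drops with every erasure.
  obtain ⟨n, hn⟩ : ∃ n, n = ∑ r ∈ S.rel.toFinset, r.card := ⟨_, rfl⟩
  induction n using Nat.strong_induction_on generalizing S with
  | _ n ih =>
    by_cases h : ∀ r ∈ S.rel, (r.card : ℤ) ≤ S.dim r + 1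
    · exact ⟨S, hS, hC, h⟩
    · obtain ⟨T, hT, hTC, r, hr, x, hx, hnot, hrel⟩ := exists_erase_presents hS hC h
      refine ih _ ?_ hT hTC rfl
      have h1 : T.rel.toFinset = insert (r.erase x) (S.rel.toFinset.erase r) := by
        ext a
        simp [hrel, and_comm]
      rw [hn, h1, Finset.sum_insert (by simp [hnot]),
        ← Finset.add_sum_erase _ _ (Set.mem_toFinset.2 hr)]
      exact Nat.add_lt_add_right (Finset.card_erase_lt_of_mem hx) _

end SetSystem

/-! ### Comparison with a presentation of bounded size -/

theorem mainTheorem8 {A : Type*} [Finite A] (k : ℕ∞) (P : Pregeometry A) (hP : P.InPG k)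
    (C : Finset A) :
    Pregeometry.SelfSufficientIn ⊤ C P ↔ Pregeometry.SelfSufficientIn k C P := by
  have := Fintype.ofFinite A
  constructor
  · rintro ⟨S, _, hS, hC⟩
    obtain ⟨R, hRk, hR⟩ := hP
    obtain ⟨T, hT, hTC, hcard⟩ := SetSystem.exists_presents_card_le hS hC
    refine ⟨T, fun s hs => ?_, hT, hTC⟩
    obtain ⟨r, hr, e⟩ := SetSystem.exists_mem_rel_cl_eq hT hR hs
    obtain ⟨X, hX⟩ : ∃ X : Finset A, (X : Set A) = P.cl (s : Set A) :=
      ⟨(P.cl (s : Set A)).toFinite.toFinset, by simp⟩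
    have h1 : T.dim X = T.dim s :=
      T.dim_eq_of_coe_eq_cl (by rw [hX, ← hT, SetSystem.cl_PG])
    have h2 : R.dim X = R.dim r :=
      R.dim_eq_of_coe_eq_cl (by rw [hX, ← e, ← hR, SetSystem.cl_PG])
    have h3 := SetSystem.dim_eq_of_presents hT hR X
    have h4 := R.dim_lt_card hr
    have h5 := hcard s hs
    -- `|s| ≤ d(s) + 1 = d(r) + 1 ≤ |r|`, the dimensions agreeing because both equal that of the
    -- common closure `X`.
    have h6 : s.card ≤ r.card := by omega
    exact le_trans (by exact_mod_cast h6) (hRk r hr)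
  · rintro ⟨S, _, hS, hC⟩
    exact ⟨S, fun _ _ => le_top, hS, hC⟩
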